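/- For $n\ge 0$ let $\Delta_n=\{(x_0,\dots,x_n)\in\mathbb R^{n+1} : x_l\ge 0,\ \sum_l x_l=1\}$ with the Euclidean topology. For $n\ge1$, $i\in\{0,1\}$ and $j\in\{0,\dots,n\}$ put $v=\frac{i}{2(n+1)}$ and let $\langle id\rangle_{n,i,j}:\Delta_{n-1}\to\Delta_n$ be the map $$(x_0,\dots,x_{n-1})\mapsto\big((1-v)x_0,\dots,(1-v)x_{j-1},\,v,\,(1-v)x_j,\dots,(1-v)x_{n-1}\big).$$ Let $\mathcal{COMFORT}(\Delta_n)$ be the set of homeomorphisms $F:\Delta_n\to\Delta_n$ that respect permutations (if $F(x)=y$, then $F(x_{\vartheta(0)},\dots,x_{\vartheta(n)})=(y_{\vartheta(0)},\dots,y_{\vartheta(n)})$ for every permutation $\vartheta$ of $\{0,\dots,n\}$) and keep the order (if $F(x)=y$ and $x_{\vartheta(0)}\le\dots\le x_{\vartheta(n)}$, then $y_{\vartheta(0)}\le\dots\le y_{\vartheta(n)}$). For $\alpha\in[0,1]$ the $\alpha$-cross of $\Delta_n$ is the set of the $x\in\Delta_n$ that have at least one coordinate equal to $\alpha$. For an increasing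 homeomorphism $f$ of $[0,\frac1{n+1}]$ let $\Lambda_n(f)$ be the map $x\mapsto y$ on $\Delta_n$ with $y_l=f(x_l)$ if $x_l\le\frac1{n+1}$ and $y_l=x_l+\delta\,(x_l-\frac1{n+1})$ if $x_l>\frac1{n+1}$, where $$\delta=\frac{\sum_{x_l\le 1/(n+1)}(x_l-f(x_l))}{\sum_{x_l>1/(n+1)}(x_l-\frac1{n+1})}.$$ Let $\phi_{n,0}$ be the piecewise linear function on $[0,\frac1{n+1}]$ through $(0,0)$, $\big(\frac1{2(n+1)},\frac1{2(n+2)}\big)$, $\big(\frac1{n+1},\frac1{n+1}\big)$, and put $\Theta_{n,0}=\Lambda_n(\phi_{n,0})$ for all $n\ge0$. **Theorem.** For every $n\ge 0$ the map $\Theta_{n,0}$ is an element of $\mathcal{COMFORT}(\Delta_n)$, and there are homeomorphisms $\Theta_{n,1}\in\mathcal{COMFORT}(\Delta_n)$, $n\ge 0$, with the following properties. 1. For all $n\ge1$, all $j,p\in\{0,\dots,n\}$ with $j\le p$ and all $i,k\in\{0,1\}$, as maps $\Delta_{n-1}\to\Delta_{n+1}$, $$\langle id\rangle_{n+1,i,j}\circ\Theta_{n,i}\circ\langle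 id\rangle_{n,k,p}\circ\Theta_{n-1,k}=\langle id\rangle_{n+1,k,p+1}\circ\Theta_{n,k}\circ\langle id\rangle_{n,i,j}\circ\Theta_{n-1,i}.$$ 2. For every $n\ge0$, $\Theta_{n,1}$ restricts to a homeomorphism of the $\frac1{2(n+1)}$-cross of $\Delta_n$ onto the $\frac1{2(n+1)+1}$-cross of $\Delta_n$. 3. Let $R$ be a commutative ring with unit, $(m_0,m_1)\in R^2$, $X$ a topological space, and $\mathcal F_n(X)$ the free $R$-module on the continuous maps $\Delta_n\to X$. Let $\partial_n:\mathcal F_n(X)\to\mathcal F_{n-1}(X)$, $n\ge1$, be the $R$-linear map with $$\partial_n(T)=\sum_{j=0}^n(-1)^j\sum_{i=0}^1 m_i\,\big[T\circ\langle id\rangle_{n,i,j}\circ\Theta_{n-1,i}\big]$$ for every continuous $T:\Delta_n\to X$. Then $\partial_n\circ\partial_{n+1}=0$ for all $n\ge1$; that is, the modules $\mathcal F_n(X)$, $n\ge 0$, with the maps $\partial_n$ (and $\partial_0=0$) form a chain complex. -/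

import Mathlib

open scoped BigOperators

noncomputable section

namespace SimplexBoundary

/-- The standard `n`-simplex `Δ_n ⊆ ℝ^{n+1}` with the Euclidean topology. -/
abbrev Simplex (n : ℕ) : Type := stdSimplex ℝ (Fin (n + 1))

/-- The height `v = i / ((L + 1) (n + 1))` of the `i`-th simplex parallel to a face of `Δ_n`. -/
def height (L n : ℕ) (i : Fin (L + 1)) : ℝ :=
  ((i : ℕ) : ℝ) / (((L : ℝ) + 1) * ((n : ℝ) + 1))

theorem height_nonneg (L n : ℕ) (i : Fin (L + 1)) : 0 ≤ height L n i := by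
  unfold height
  positivity

theorem height_le_one (L n : ℕ) (i : Fin (L + 1)) : height L n i ≤ 1 := by
  unfold height
  have hi : ((i : ℕ) : ℝ) ≤ (L : ℝ) := by exact_mod_cast Nat.lt_succ_iff.mp i.isLt
  have hL : (0 : ℝ) ≤ L := Nat.cast_nonneg L
  have hn : (0 : ℝ) ≤ n := Nat.cast_nonneg n
  rw [div_le_one (by positivity)]
  nlinarith [mul_nonneg hL hn]

/-- The map `⟨id⟩_{L, n+1, i, j} : Δ_n → Δ_{n+1}`,
`(x_0, …, x_n) ↦ (y_0, …, y_{j-1}, v, y_j, …, y_n)` with `v = i / ((L + 1) (n + 2))` and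
`y_k = (1 - v) x_k`. -/
def faceMap (L n : ℕ) (i : Fin (L + 1)) (j : Fin (n + 2)) : C(Simplex n, Simplex (n + 1)) where
  toFun x :=
    ⟨j.insertNth (α := fun _ => ℝ) (height L (n + 1) i)
        (fun k => (1 - height L (n + 1) i) * x k), by
      refine ⟨fun k => ?_, ?_⟩
      · refine Fin.succAboveCases j ?_ (fun l => ?_) k
        · simpa using height_nonneg L (n + 1) i
        · simp only [Fin.insertNth_apply_succAbove]
          exact mul_nonneg (sub_nonneg.mpr (height_le_one L (n + 1) i)) (x.2.1 l)
      · rw [Fin.sum_univ_succAbove _ j]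
        simp only [Fin.insertNth_apply_same, Fin.insertNth_apply_succAbove]
        have hx : ∑ l, x l = 1 := x.2.2
        rw [← Finset.mul_sum, hx]
        ring⟩
  continuous_toFun := by
    refine Continuous.subtype_mk (continuous_pi fun k => ?_) _
    refine Fin.succAboveCases j ?_ (fun l => ?_) k
    · simpa using continuous_const
    · simp only [Fin.insertNth_apply_succAbove]
      exact continuous_const.mul ((continuous_apply l).comp continuous_subtype_val)

/-- A family of self-homeomorphisms `Θ_{L,n,i}` of `Δ_n`, for `n ≥ 0` and `i = 0, …, L`. -/
abbrev HomeoFamily (L : ℕ) : Type := (n : ℕ) → Fin (L + 1) → (Simplex n ≃ₜ Simplex n)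

/-- With `N = n + 1 ≥ 1` and `j, p ∈ {0, …, N}`, the equation
`⟨id⟩_{N+1,i,j} ∘ Θ_{N,i} ∘ ⟨id⟩_{N,k,p} ∘ Θ_{N-1,k}
  = ⟨id⟩_{N+1,k,p+1} ∘ Θ_{N,k} ∘ ⟨id⟩_{N,i,j} ∘ Θ_{N-1,i}` of maps `Δ_{N-1} → Δ_{N+1}`. -/
def FaceEquation (L : ℕ) (Θ : HomeoFamily L) (n : ℕ) (j p : Fin (n + 2))
    (i k : Fin (L + 1)) : Prop :=
  ∀ x : Simplex n,
    faceMap L (n + 1) i j.castSucc (Θ (n + 1) i (faceMap L n k p (Θ n k x))) =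
      faceMap L (n + 1) k p.succ (Θ (n + 1) k (faceMap L n i j (Θ n i x)))

/-- `F` respects permutations of the coordinates. -/
def RespectsPermutations {n : ℕ} (F : Simplex n → Simplex n) : Prop :=
  ∀ (σ : Equiv.Perm (Fin (n + 1))) (x x' : Simplex n),
    (∀ l, x' l = x (σ l)) →
      ∀ l, (F x') l = (F x) (σ l)

/-- `F` keeps the order of the coordinates: a permutation that sorts the coordinates of `x`
sorts those of `F x`. -/
def KeepsOrder {n : ℕ} (F : Simplex n → Simplex n) : Prop :=
  ∀ (x : Simplex n) (σ : Equiv.Perm (Fin (n + 1))),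
    Monotone (fun l => x (σ l)) →
      Monotone (fun l => (F x) (σ l))

/-- `COMFORT(Δ_n)`: the homeomorphisms of `Δ_n` that respect permutations and keep the order. -/
def Comfort (n : ℕ) : Set (Simplex n ≃ₜ Simplex n) :=
  {F | RespectsPermutations F ∧ KeepsOrder F}

/-- The `α`-cross of `Δ_n`. -/
def cross (n : ℕ) (α : ℝ) : Set (Simplex n) :=
  {x | ∃ j, x j = α}

/-- The number `D` in the construction of `Λ_n(f)`: the total decrease of the coordinates that
are at most `1 / (n + 1)` when `f` is applied to them. -/
def lambdaD (n : ℕ) (f : ℝ → ℝ) (x : Fin (n + 1) → ℝ) : ℝ :=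
  ∑ i, if x i ≤ 1 / ((n : ℝ) + 1) then x i - f (x i) else 0

/-- The number `δ` in the construction of `Λ_n(f)`. -/
def lambdaDelta (n : ℕ) (f : ℝ → ℝ) (x : Fin (n + 1) → ℝ) : ℝ :=
  lambdaD n f x /
    ∑ i, if x i ≤ 1 / ((n : ℝ) + 1) then 0 else x i - 1 / ((n : ℝ) + 1)

/-- The coordinates of `Λ_n(f)(x)`, for `f` an increasing homeomorphism of `[0, 1 / (n + 1)]`:
`f` is applied to the coordinates that are at most `1 / (n + 1)`, and the excess over
`1 / (n + 1)` of each other coordinate is multiplied by `1 + δ`. -/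
def Lambda (n : ℕ) (f : ℝ → ℝ) (x : Fin (n + 1) → ℝ) : Fin (n + 1) → ℝ := fun i =>
  if x i ≤ 1 / ((n : ℝ) + 1) then f (x i)
  else x i + lambdaDelta n f x * (x i - 1 / ((n : ℝ) + 1))

/-- The affine function through `(a, b)` and `(c, d)`, for `a ≠ c`. -/
def lineThrough (a b c d t : ℝ) : ℝ := b + (d - b) / (c - a) * (t - a)

/-- `φ_{n,0}`: the polygon through `(0, 0)`, `(1 / (2 (n + 1)), 1 / (2 (n + 2)))` and
`(1 / (n + 1), 1 / (n + 1))`. -/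
def phi (n : ℕ) (t : ℝ) : ℝ :=
  if t ≤ 1 / (2 * ((n : ℝ) + 1)) then
    lineThrough 0 0 (1 / (2 * ((n : ℝ) + 1))) (1 / (2 * ((n : ℝ) + 2))) t
  else
    lineThrough (1 / (2 * ((n : ℝ) + 1))) (1 / (2 * ((n : ℝ) + 2)))
      (1 / ((n : ℝ) + 1)) (1 / ((n : ℝ) + 1)) t

/-- The singular `n`-chains of `X`: the free `R`-module on the continuous maps `Δ_n → X`. -/
abbrev Chain (R : Type*) [CommRing R] (X : Type*) [TopologicalSpace X] (n : ℕ) : Type _ :=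
  C(Simplex n, X) →₀ R

/-- The operator `∂_{n+1}` from `(n+1)`-chains to `n`-chains, the linear extension of
`T ↦ ∑_{j=0}^{n+1} (-1)^j ∑_{i=0}^{L} m_i [⟨T⟩_{L,n+1,i,j} ∘ Θ_{L,n,i}]`,
where `⟨T⟩_{L,n+1,i,j} = T ∘ ⟨id⟩_{L,n+1,i,j}`. -/
def boundary {L : ℕ} (Θ : HomeoFamily L) {R : Type*} [CommRing R] (m : Fin (L + 1) → R)
    (X : Type*) [TopologicalSpace X] (n : ℕ) : Chain R X (n + 1) →ₗ[R] Chain R X n :=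
  Finsupp.linearCombination R fun T : C(Simplex (n + 1), X) =>
    ∑ j : Fin (n + 2), (-1 : R) ^ (j : ℕ) • ∑ i : Fin (L + 1),
      m i • Finsupp.single ((T.comp (faceMap L n i j)).comp
        (Θ n i : C(Simplex n, Simplex n))) (1 : R)

end SimplexBoundary

end

open SimplexBoundary

/-
For `i = 1`, `k = 0` the face equation prescribes `Θ_{n+1,1}` on the faces of `Δ_{n+1}`: it has to
be `V ∘ Θ_{n,1} ∘ Θ_{n,0}⁻¹` there, where `V` is the map that `Θ_{n+1,0}` induces between the slices
at the heights `1 / (2 (n + 2))` and `1 / (2 (n + 3))`. So `Θ_{n,1}` is constructed by induction on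
`n`. To extend a map from the faces one would cone it from the barycenter, but this spoils the
condition that small coordinates are merely rescaled, which the induction and the equation for
`i = k = 1` need. Therefore the rescaling is first carried out by a map `Λ(f)` with a polygon `f`;
what is left to be extended fixes all small coordinates, and so does its cone. Both maps respect
permutations and keep the order, so the same map is induced on all parallel faces, and the face
equations follow by comparing coordinates. They match the terms of `∂ ∘ ∂` in pairs with opposite
signs.
-/

noncomputable section

namespace SimplexBoundary

variable {n : ℕ}

theorem continuous_of_coord {Y : Type*} [TopologicalSpace Y] {f : Y → Simplex n}
    (h : ∀ l, Continuous fun y => f y l) : Continuous f :=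
  continuous_induced_rng.2 (continuous_pi h)

theorem continuous_coord (l : Fin (n + 1)) : Continuous fun x : Simplex n => x l :=
  (continuous_apply l).comp continuous_subtype_val

/-- The right action of a permutation `σ` on the simplex: the `l`-th coordinate of `permute σ x`
is `x (σ l)`. -/
def permute (σ : Equiv.Perm (Fin (n + 1))) (x : Simplex n) : Simplex n :=
  ⟨fun l => x (σ l), fun l => x.2.1 (σ l), (Equiv.sum_comp σ (fun l => x l)).trans x.2.2⟩

@[simp]
theorem permute_apply (σ : Equiv.Perm (Fin (n + 1))) (x : Simplex n) (l : Fin (n + 1)) :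
    permute σ x l = x (σ l) := rfl

theorem permute_swap_of_apply_eq {x : Simplex n} {i j : Fin (n + 1)} (h : x i = x j) :
    permute (Equiv.swap i j) x = x := by
  ext l
  rw [permute_apply, Equiv.swap_apply_def]
  grind

theorem respectsPermutations_iff {F : Simplex n → Simplex n} :
    RespectsPermutations F ↔ ∀ σ x, F (permute σ x) = permute σ (F x) := by
  refine ⟨fun h σ x => DFunLike.ext _ _ (h σ x _ fun _ => rfl), fun h σ x x' hx l => ?_⟩
  obtain rfl : x' = permute σ x := DFunLike.ext _ _ hx
  rw [h, permute_apply]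

theorem exists_perm_monotone_of_apply_le {x : Simplex n} {i j : Fin (n + 1)} (h : x i ≤ x j) :
    ∃ σ : Equiv.Perm (Fin (n + 1)),
      Monotone (fun l => x (σ l)) ∧ σ.symm i ≤ σ.symm j := by
  have hsort : Monotone fun l => x (Tuple.sort (⇑x) l) := Tuple.monotone_sort ⇑x
  obtain hij | hji := le_total ((Tuple.sort ⇑x).symm i) ((Tuple.sort ⇑x).symm j)
  · exact ⟨_, hsort, hij⟩
  · have heq : x i = x j := h.antisymm (by simpa using hsort hji)
    refine ⟨(Tuple.sort ⇑x).trans (Equiv.swap i j), ?_, by simpa using hji⟩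
    have hswap (l) : x (Equiv.swap i j l) = x l :=
      DFunLike.congr_fun (permute_swap_of_apply_eq heq) l
    simpa only [Equiv.trans_apply, hswap] using hsort

theorem keepsOrder_iff {F : Simplex n → Simplex n} :
    KeepsOrder F ↔ ∀ x i j, x i ≤ x j → F x i ≤ F x j := by
  refine ⟨fun h x i j hij => ?_, fun h x σ hσ i j hij => h x _ _ (hσ hij)⟩
  obtain ⟨σ, hσ, hle⟩ := exists_perm_monotone_of_apply_le hij
  simpa using h x σ hσ hle

theorem permute_comm_of_mem_comfort {F : Simplex n ≃ₜ Simplex n} (hF : F ∈ Comfort n)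
    (σ : Equiv.Perm (Fin (n + 1))) (x : Simplex n) : F (permute σ x) = permute σ (F x) :=
  respectsPermutations_iff.1 hF.1 σ x

/-- A transposition that fixes `F x` fixes `x` by equivariance, so `F` cannot merge coordinates. -/
theorem apply_le_apply_iff_of_mem_comfort {F : Simplex n ≃ₜ Simplex n} (hF : F ∈ Comfort n)
    (x : Simplex n) (i j : Fin (n + 1)) : F x i ≤ F x j ↔ x i ≤ x j := by
  refine ⟨fun h => ?_, keepsOrder_iff.1 hF.2 x i j⟩
  by_contra! hji
  have heq : F x i = F x j := h.antisymm (keepsOrder_iff.1 hF.2 x j i hji.le)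
  have hfix : permute (Equiv.swap i j) x = x := F.injective <| by
    rw [permute_comm_of_mem_comfort hF, permute_swap_of_apply_eq heq]
  have hij : x j = x i := by simpa using DFunLike.congr_fun hfix i
  exact hji.ne hij

theorem refl_mem_comfort : Homeomorph.refl (Simplex n) ∈ Comfort n :=
  ⟨fun _ _ _ h => h, fun _ _ h => h⟩

theorem trans_mem_comfort {F G : Simplex n ≃ₜ Simplex n} (hF : F ∈ Comfort n)
    (hG : G ∈ Comfort n) : F.trans G ∈ Comfort n :=
  ⟨fun σ x x' h => hG.1 σ (F x) (F x') (hF.1 σ x x' h), fun x σ h => hG.2 (F x) σ (hF.2 x σ h)⟩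

theorem symm_mem_comfort {F : Simplex n ≃ₜ Simplex n} (hF : F ∈ Comfort n) :
    F.symm ∈ Comfort n := by
  refine ⟨respectsPermutations_iff.2 fun σ x => ?_, keepsOrder_iff.2 fun x i j h => ?_⟩
  · rw [F.symm_apply_eq, permute_comm_of_mem_comfort hF, F.apply_symm_apply]
  · rwa [← apply_le_apply_iff_of_mem_comfort hF, F.apply_symm_apply]

/-- `F` multiplies the coordinates that are at most `a` by `b / a`, and moves the coordinates above
`a` to values above `b`. -/
structure ScalesBelow (F : Simplex n → Simplex n) (a b : ℝ) : Prop where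
  pos_left : 0 < a
  pos_right : 0 < b
  apply_eq_mul : ∀ x i, x i ≤ a → F x i = b / a * x i
  lt_apply : ∀ x i, a < x i → b < F x i

namespace ScalesBelow

variable {F : Simplex n → Simplex n} {a b c : ℝ}

theorem mul_le_iff (h : ScalesBelow F a b) {t : ℝ} : b / a * t ≤ b ↔ t ≤ a := by
  rw [div_mul_eq_mul_div, div_le_iff₀ h.pos_left, mul_le_mul_iff_right₀ h.pos_right]

theorem apply_le_iff (h : ScalesBelow F a b) (x : Simplex n) (i : Fin (n + 1)) :
    F x i ≤ b ↔ x i ≤ a := by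
  refine ⟨fun hx => not_lt.1 fun hlt => (h.lt_apply x i hlt).not_ge hx, fun hx => ?_⟩
  rwa [h.apply_eq_mul x i hx, h.mul_le_iff]

theorem apply_eq_mul_iff (h : ScalesBelow F a b) {t : ℝ} (ht : t ≤ a) (x : Simplex n)
    (i : Fin (n + 1)) : F x i = b / a * t ↔ x i = t := by
  refine ⟨fun hx => ?_, ?_⟩
  · have hle : x i ≤ a := (h.apply_le_iff x i).1 (hx ▸ h.mul_le_iff.2 ht)
    exact mul_left_cancel₀ (div_pos h.pos_right h.pos_left).ne'
      ((h.apply_eq_mul x i hle).symm.trans hx)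
  · rintro rfl
    exact h.apply_eq_mul x i ht

theorem apply_eq_zero_iff (h : ScalesBelow F a b) (x : Simplex n) (i : Fin (n + 1)) :
    F x i = 0 ↔ x i = 0 := by
  simpa using h.apply_eq_mul_iff h.pos_left.le x i

theorem apply_eq_iff (h : ScalesBelow F a b) (x : Simplex n) (i : Fin (n + 1)) :
    F x i = b ↔ x i = a := by
  simpa [h.pos_left.ne'] using h.apply_eq_mul_iff le_rfl x i

protected theorem trans {F G : Simplex n ≃ₜ Simplex n} (hF : ScalesBelow F a b)
    (hG : ScalesBelow G b c) : ScalesBelow (F.trans G) a c where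
  pos_left := hF.pos_left
  pos_right := hG.pos_right
  apply_eq_mul x i hx := by
    rw [Homeomorph.trans_apply, hG.apply_eq_mul _ _ ((hF.apply_le_iff x i).2 hx),
      hF.apply_eq_mul x i hx, ← mul_assoc, div_mul_div_cancel₀ hF.pos_right.ne']
  lt_apply x i hx := hG.lt_apply _ _ (hF.lt_apply x i hx)

protected theorem symm {F : Simplex n ≃ₜ Simplex n} (h : ScalesBelow F a b) :
    ScalesBelow F.symm b a where
  pos_left := h.pos_right
  pos_right := h.pos_left
  apply_eq_mul x i hx := by
    obtain ⟨y, rfl⟩ := F.surjective x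
    rw [F.symm_apply_apply, h.apply_eq_mul y i ((h.apply_le_iff y i).1 hx), ← mul_assoc,
      div_mul_div_cancel₀ h.pos_right.ne', div_self h.pos_left.ne', one_mul]
  lt_apply x i hx := by
    rwa [← not_le, ← h.apply_le_iff, F.apply_symm_apply, not_le]

/-- The restriction to crosses of a homeomorphism that scales the coordinates below `a`. -/
def crossHomeomorph {F : Simplex n ≃ₜ Simplex n} (h : ScalesBelow F a b) :
    cross n a ≃ₜ cross n b :=
  F.subtype fun x => exists_congr fun i => (h.apply_eq_iff x i).symm

end ScalesBelow

/-- The point of `Δ_{n+1}` with the coordinate `a` inserted at position `j` and the other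
coordinates multiplied by `1 - a`: `faceMap` with an arbitrary height. -/
def insertCoord (a : unitInterval) (j : Fin (n + 2)) (x : Simplex n) : Simplex (n + 1) :=
  ⟨j.insertNth (α := fun _ => ℝ) (a : ℝ) (fun k => (1 - (a : ℝ)) * x k), by
    refine ⟨fun l => ?_, ?_⟩
    · refine Fin.succAboveCases j ?_ (fun k => ?_) l
      · simpa only [Fin.insertNth_apply_same] using a.2.1
      · simpa only [Fin.insertNth_apply_succAbove] using
          mul_nonneg (sub_nonneg.2 a.2.2) (stdSimplex.zero_le x k)
    · simp only [Fin.sum_univ_succAbove _ j, Fin.insertNth_apply_same,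
        Fin.insertNth_apply_succAbove, ← Finset.mul_sum, stdSimplex.sum_eq_one x]
      ring⟩

@[simp]
theorem insertCoord_apply_same (a : unitInterval) (j : Fin (n + 2)) (x : Simplex n) :
    insertCoord a j x j = a :=
  Fin.insertNth_apply_same (α := fun _ => ℝ) j (a : ℝ) fun k => (1 - (a : ℝ)) * x k

@[simp]
theorem insertCoord_apply_succAbove (a : unitInterval) (j : Fin (n + 2)) (x : Simplex n)
    (k : Fin (n + 1)) : insertCoord a j x (j.succAbove k) = (1 - a) * x k :=
  Fin.insertNth_apply_succAbove (α := fun _ => ℝ) j (a : ℝ) (fun k => (1 - (a : ℝ)) * x k) k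

/-- `height L n i` as an element of the unit interval. -/
def unitHeight (L n : ℕ) (i : Fin (L + 1)) : unitInterval :=
  ⟨height L n i, height_nonneg L n i, height_le_one L n i⟩

theorem faceMap_apply (L n : ℕ) (i : Fin (L + 1)) (j : Fin (n + 2)) (x : Simplex n) :
    faceMap L n i j x = insertCoord (unitHeight L (n + 1) i) j x := rfl

theorem ext_succAbove {x y : Simplex (n + 1)} (j : Fin (n + 2)) (h : x j = y j)
    (h' : ∀ k, x (j.succAbove k) = y (j.succAbove k)) : x = y := by
  ext l
  exact Fin.succAboveCases j h h' l

theorem continuous_insertCoord (a : unitInterval) (j : Fin (n + 2)) :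
    Continuous (insertCoord (n := n) a j) := by
  refine continuous_of_coord fun l => Fin.succAboveCases j ?_ (fun k => ?_) l
  · simpa only [insertCoord_apply_same] using continuous_const
  · simpa only [insertCoord_apply_succAbove] using (continuous_coord k).const_mul (1 - (a : ℝ))

theorem one_sub_coe_pos {a : unitInterval} (ha : a < 1) : 0 < 1 - (a : ℝ) :=
  sub_pos.2 ha

/-- For `a < 1`, inserting the coordinate `a` at position `j` identifies `Δ_n` with the slice
`{z | z j = a}` of `Δ_{n+1}`. -/
def sliceHomeomorph {a : unitInterval} (ha : a < 1) (j : Fin (n + 2)) :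
    Simplex n ≃ₜ {z : Simplex (n + 1) // z j = a} where
  toFun x := ⟨insertCoord a j x, insertCoord_apply_same a j x⟩
  invFun z := ⟨fun k => (1 - (a : ℝ))⁻¹ * z.1 (j.succAbove k), by
    have ha' := one_sub_coe_pos ha
    refine ⟨fun k => mul_nonneg (inv_nonneg.2 ha'.le) (stdSimplex.zero_le z.1 _), ?_⟩
    have hsum := stdSimplex.sum_eq_one z.1
    rw [Fin.sum_univ_succAbove _ j, z.2] at hsum
    rw [← Finset.mul_sum, eq_sub_of_add_eq' hsum, inv_mul_cancel₀ ha'.ne']⟩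
  left_inv x := by
    ext k
    change (1 - (a : ℝ))⁻¹ * insertCoord a j x (j.succAbove k) = x k
    rw [insertCoord_apply_succAbove, inv_mul_cancel_left₀ (one_sub_coe_pos ha).ne']
  right_inv z := by
    refine Subtype.ext (ext_succAbove j ?_ fun k => ?_)
    · rw [insertCoord_apply_same, z.2]
    · rw [insertCoord_apply_succAbove]
      exact mul_inv_cancel_left₀ (one_sub_coe_pos ha).ne' _
  continuous_toFun := (continuous_insertCoord a j).subtype_mk _
  continuous_invFun := continuous_of_coord fun k =>
    continuous_const.mul ((continuous_coord _).comp continuous_subtype_val)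

theorem insertCoord_injective {a : unitInterval} (ha : a < 1) (j : Fin (n + 2)) :
    Function.Injective (insertCoord (n := n) a j) := fun _ _ h =>
  (sliceHomeomorph ha j).injective (Subtype.ext h)

/-- The permutation that sends `j` to `j'` and acts as `σ` between their complements. -/
def extendPerm (j j' : Fin (n + 2)) (σ : Equiv.Perm (Fin (n + 1))) : Equiv.Perm (Fin (n + 2)) :=
  (finSuccEquiv' j).trans ((Equiv.optionCongr σ).trans (finSuccEquiv' j').symm)

@[simp]
theorem extendPerm_apply_self (j j' : Fin (n + 2)) (σ : Equiv.Perm (Fin (n + 1))) :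
    extendPerm j j' σ j = j' := by
  simp [extendPerm]

@[simp]
theorem extendPerm_apply_succAbove (j j' : Fin (n + 2)) (σ : Equiv.Perm (Fin (n + 1)))
    (k : Fin (n + 1)) : extendPerm j j' σ (j.succAbove k) = j'.succAbove (σ k) := by
  simp [extendPerm]

theorem exists_eq_extendPerm (τ : Equiv.Perm (Fin (n + 2))) (j : Fin (n + 2)) :
    ∃ σ : Equiv.Perm (Fin (n + 1)), τ = extendPerm j (τ j) σ := by
  have h : ∀ k, ∃ k', (τ j).succAbove k' = τ (j.succAbove k) := fun k =>
    Fin.exists_succAbove_eq (τ.injective.ne (Fin.succAbove_ne j k))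
  choose f hf using h
  have hf_inj : Function.Injective f := fun k k' hk =>
    Fin.succAbove_right_injective (τ.injective (by rw [← hf k, ← hf k', hk]))
  refine ⟨Equiv.ofBijective f (Finite.injective_iff_bijective.1 hf_inj), Equiv.ext fun l => ?_⟩
  exact Fin.succAboveCases j (by simp) (fun k => by simp [hf k]) l

theorem insertCoord_permute (a : unitInterval) (j j' : Fin (n + 2))
    (σ : Equiv.Perm (Fin (n + 1))) (x : Simplex n) :
    insertCoord a j (permute σ x) = permute (extendPerm j j' σ) (insertCoord a j' x) :=
  ext_succAbove j (by simp) (by simp)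

theorem insertCoord_eq_permute (a : unitInterval) (j j' : Fin (n + 2)) (x : Simplex n) :
    insertCoord a j x = permute (extendPerm j j' 1) (insertCoord a j' x) :=
  insertCoord_permute a j _ 1 x

/-- `F` maps each slice `{z | z j = a}` of `Δ_{n+1}` into the slice `{z | z j = b}`, and in the
coordinates of these slices it is the map `F'`, the same for all `j`. -/
def InducesOnSlices (F : Simplex (n + 1) → Simplex (n + 1)) (a b : unitInterval)
    (F' : Simplex n → Simplex n) : Prop :=
  ∀ j x, F (insertCoord a j x) = insertCoord b j (F' x)

theorem exists_inducesOnSlices {F : Simplex (n + 1) ≃ₜ Simplex (n + 1)} (hF : F ∈ Comfort (n + 1))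
    {a b : unitInterval} (ha : a < 1) (hb : b < 1) (hab : ∀ x j, F x j = b ↔ x j = a) :
    ∃ F' : Simplex n ≃ₜ Simplex n, InducesOnSlices F a b F' := by
  let F' := (sliceHomeomorph ha 0).trans
    ((F.subtype fun x => (hab x 0).symm).trans (sliceHomeomorph hb 0).symm)
  have hzero (x) : F (insertCoord a 0 x) = insertCoord b 0 (F' x) :=
    (congrArg Subtype.val ((sliceHomeomorph hb 0).apply_symm_apply
      ⟨F (insertCoord a 0 x), (hab _ 0).2 (insertCoord_apply_same a 0 x)⟩)).symm
  refine ⟨F', fun j x => ?_⟩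
  rw [insertCoord_eq_permute a j 0, permute_comm_of_mem_comfort hF, hzero,
    ← insertCoord_eq_permute]

namespace InducesOnSlices

variable {a b : unitInterval}

theorem mem_comfort {F : Simplex (n + 1) ≃ₜ Simplex (n + 1)} {F' : Simplex n ≃ₜ Simplex n}
    (h : InducesOnSlices F a b F') (hF : F ∈ Comfort (n + 1)) (hb : b < 1) :
    F' ∈ Comfort n := by
  refine ⟨respectsPermutations_iff.2 fun σ x => insertCoord_injective hb 0 ?_,
    keepsOrder_iff.2 fun x i j hij => ?_⟩
  · rw [← h, insertCoord_permute a 0 0, permute_comm_of_mem_comfort hF, h, ← insertCoord_permute]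
  · have hij' :
        insertCoord a 0 x (Fin.succAbove 0 i) ≤ insertCoord a 0 x (Fin.succAbove 0 j) := by
      simpa only [insertCoord_apply_succAbove] using
        mul_le_mul_of_nonneg_left hij (sub_nonneg.2 a.2.2)
    have hle := keepsOrder_iff.1 hF.2 _ _ _ hij'
    rw [h] at hle
    simpa only [insertCoord_apply_succAbove, mul_le_mul_iff_right₀ (one_sub_coe_pos hb)] using hle

theorem scalesBelow {F : Simplex (n + 1) → Simplex (n + 1)} {F' : Simplex n → Simplex n}
    {A B : ℝ} (h : InducesOnSlices F a b F') (hF : ScalesBelow F A B) (ha : a < 1) (hb : b < 1) :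
    ScalesBelow F' (A / (1 - a)) (B / (1 - b)) := by
  have ha' := one_sub_coe_pos ha
  have hb' := one_sub_coe_pos hb
  have hcoord (x i) : F (insertCoord a 0 x) (Fin.succAbove 0 i) = (1 - b) * F' x i := by
    rw [h, insertCoord_apply_succAbove]
  refine ⟨div_pos hF.pos_left ha', div_pos hF.pos_right hb', fun x i hx => ?_, fun x i hx => ?_⟩
  · have heq := hF.apply_eq_mul (insertCoord a 0 x) (Fin.succAbove 0 i) (by
      rwa [insertCoord_apply_succAbove, ← le_div_iff₀' ha'])
    rw [hcoord, insertCoord_apply_succAbove] at heq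
    rw [← mul_div_cancel_left₀ (F' x i) hb'.ne', heq]
    field_simp
  · have hlt := hF.lt_apply (insertCoord a 0 x) (Fin.succAbove 0 i) (by
      rwa [insertCoord_apply_succAbove, ← div_lt_iff₀' ha'])
    rwa [hcoord, ← div_lt_iff₀' hb'] at hlt

end InducesOnSlices

/-- The coordinate `c` of the left-hand side comes from the inner insertion, the coordinate `v` of
the right-hand side from its inner insertion. -/
theorem insertCoord_insertCoord {a b c v : unitInterval} (hc : (1 - v : ℝ) * b = c)
    (hv : (1 - c : ℝ) * a = v) (j : Fin (n + 3)) (p : Fin (n + 2)) (x : Simplex n) :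
    insertCoord v j (insertCoord b p x) =
      insertCoord c (j.succAbove p) (insertCoord a (p.predAbove j) x) := by
  have hprod : (1 - v : ℝ) * (1 - b) = (1 - c) * (1 - a) := by linear_combination hv - hc
  have hright (y) : insertCoord c (j.succAbove p) y j = (1 - c) * y (p.predAbove j) := by
    simpa only [Fin.succAbove_succAbove_predAbove] using
      insertCoord_apply_succAbove c (j.succAbove p) y (p.predAbove j)
  refine ext_succAbove j ?_ fun k => ?_
  · rw [hright, insertCoord_apply_same, insertCoord_apply_same, hv]
  · rw [insertCoord_apply_succAbove]
    obtain rfl | ⟨r, rfl⟩ := Fin.eq_self_or_eq_succAbove p k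
    · rw [insertCoord_apply_same, insertCoord_apply_same, hc]
    · rw [insertCoord_apply_succAbove, ← Fin.succAbove_succAbove_succAbove_predAbove,
        insertCoord_apply_succAbove, insertCoord_apply_succAbove, ← mul_assoc, hprod, mul_assoc]

theorem faceEquation_of_inducesOnSlices {L : ℕ} {Θ : HomeoFamily L} {i k : Fin (L + 1)}
    {a b : unitInterval} {H H' : Simplex n → Simplex n}
    (hH : InducesOnSlices (Θ (n + 1) i) (unitHeight L (n + 1) k) b H)
    (hH' : InducesOnSlices (Θ (n + 1) k) (unitHeight L (n + 1) i) a H')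
    (hb : (1 - height L (n + 2) i) * b = height L (n + 2) k)
    (ha : (1 - height L (n + 2) k) * a = height L (n + 2) i)
    (hΘ : ∀ x, H (Θ n k x) = H' (Θ n i x)) {j p : Fin (n + 2)} (hjp : j ≤ p) :
    FaceEquation L Θ n j p i k := fun x => by
  have h := insertCoord_insertCoord (v := unitHeight L (n + 2) i) (c := unitHeight L (n + 2) k)
    hb ha j.castSucc p (H (Θ n k x))
  rw [Fin.succAbove_of_le_castSucc _ _ (Fin.castSucc_le_castSucc_iff.2 hjp),
    Fin.predAbove_castSucc_of_le _ _ hjp] at h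
  simp only [faceMap_apply]
  rw [hH, hH', ← hΘ, h]

theorem sum_neg_one_pow_smul_eq_zero {R M : Type*} [Ring R] [AddCommGroup M] [Module R M]
    {a : Fin (n + 1) → Fin n → M} (h : ∀ j p, a (j.succAbove p) (p.predAbove j) = a j p) :
    ∑ j : Fin (n + 1), ∑ p : Fin n, (-1 : R) ^ (j + p : ℕ) • a j p = 0 := by
  rw [← Fintype.sum_prod_type' fun (j : Fin (n + 1)) (p : Fin n) => (-1 : R) ^ (j + p : ℕ) • a j p]
  refine Finset.sum_ninvolution (fun q => (q.1.succAbove q.2, q.2.predAbove q.1))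
    (fun q => ?_) (fun q _ hq => ?_) (fun q => Finset.mem_univ _) fun q => ?_
  · rw [h, Fin.neg_one_pow_succAbove_add_predAbove, neg_smul, add_neg_cancel]
  · exact Fin.succAbove_ne _ _ (congrArg Prod.fst hq)
  · exact Prod.ext (Fin.succAbove_succAbove_predAbove _ _) (Fin.predAbove_predAbove_succAbove _ _)

theorem succAbove_predAbove_invariant {M : Type*} {a : Fin (n + 2) → Fin (n + 1) → M}
    (h : ∀ j p : Fin (n + 1), j ≤ p → a j.castSucc p = a p.succ j) (j : Fin (n + 2))
    (p : Fin (n + 1)) : a (j.succAbove p) (p.predAbove j) = a j p := by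
  obtain hjp | hpj := le_or_gt j p.castSucc
  · obtain ⟨j, rfl⟩ := Fin.exists_castSucc_eq.2 (ne_of_lt (hjp.trans_lt (Fin.castSucc_lt_last p)))
    have hjp' : j ≤ p := Fin.castSucc_le_castSucc_iff.1 hjp
    rw [Fin.succAbove_of_le_castSucc _ _ hjp, Fin.predAbove_castSucc_of_le _ _ hjp', h j p hjp']
  · obtain ⟨j, rfl⟩ := Fin.exists_succ_eq.2 (Fin.ne_zero_of_lt hpj)
    have hpj' : p ≤ j := Fin.castSucc_lt_succ_iff.1 hpj
    rw [Fin.succAbove_of_castSucc_lt _ _ hpj, Fin.predAbove_succ_of_le _ _ hpj', h p j hpj']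

section Boundary

variable {L : ℕ} (Θ : HomeoFamily L) {R : Type*} [CommRing R] (m : Fin (L + 1) → R)
  {X : Type*} [TopologicalSpace X]

/-- The part of `∂ T` over the `j`-th face, without its sign:
`∑ i, m_i [T ∘ ⟨id⟩_{L,n+1,i,j} ∘ Θ_{L,n,i}]`. -/
def faceSum (T : C(Simplex (n + 1), X)) (j : Fin (n + 2)) : Chain R X n :=
  ∑ i, m i • Finsupp.single ((T.comp (faceMap L n i j)).comp (Θ n i : C(Simplex n, Simplex n))) 1

theorem boundary_single_one (T : C(Simplex (n + 1), X)) :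
    boundary Θ m X n (Finsupp.single T 1) =
      ∑ j : Fin (n + 2), (-1 : R) ^ (j : ℕ) • faceSum Θ m T j := by
  rw [boundary, Finsupp.linearCombination_single, one_smul]
  rfl

theorem boundary_faceSum (T : C(Simplex (n + 2), X)) (j : Fin (n + 3)) :
    boundary Θ m X n (faceSum Θ m T j) = ∑ p : Fin (n + 2), (-1 : R) ^ (p : ℕ) • ∑ i, m i •
      faceSum Θ m ((T.comp (faceMap L (n + 1) i j)).comp (Θ (n + 1) i : C(_, _))) p := by
  rw [faceSum]
  simp only [map_sum, map_smul, boundary_single_one, Finset.smul_sum]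
  rw [Finset.sum_comm]
  simp only [smul_comm (m _)]

theorem faceSum_faceSum {j p : Fin (n + 2)}
    (h : ∀ i k, FaceEquation L Θ n j p i k) (T : C(Simplex (n + 2), X)) :
    ∑ i, m i • faceSum Θ m
        ((T.comp (faceMap L (n + 1) i j.castSucc)).comp (Θ (n + 1) i : C(_, _))) p =
      ∑ i, m i • faceSum Θ m
        ((T.comp (faceMap L (n + 1) i p.succ)).comp (Θ (n + 1) i : C(_, _))) j := by
  simp only [faceSum, Finset.smul_sum]
  rw [Finset.sum_comm]
  refine Finset.sum_congr rfl fun k _ => Finset.sum_congr rfl fun i _ => ?_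
  rw [smul_comm]
  congr 3
  ext x
  exact congrArg T (h i k x)

theorem boundary_comp_boundary
    (h : ∀ (j p : Fin (n + 2)), j ≤ p → ∀ i k, FaceEquation L Θ n j p i k) :
    (boundary Θ m X n) ∘ₗ (boundary Θ m X (n + 1)) = 0 := by
  refine Finsupp.lhom_ext' fun T => LinearMap.ext_ring ?_
  let a (j : Fin (n + 3)) (p : Fin (n + 2)) : Chain R X n := ∑ i, m i • faceSum Θ m
    ((T.comp (faceMap L (n + 1) i j)).comp (Θ (n + 1) i : C(_, _))) p
  have ha : ∀ j p : Fin (n + 2), j ≤ p → a j.castSucc p = a p.succ j := fun j p hjp =>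
    faceSum_faceSum Θ m (h j p hjp) T
  calc boundary Θ m X n (boundary Θ m X (n + 1) (Finsupp.single T 1))
      = ∑ j : Fin (n + 3), ∑ p : Fin (n + 2), (-1 : R) ^ (j + p : ℕ) • a j p := by
        simp only [boundary_single_one, map_sum, map_smul, boundary_faceSum, pow_add, mul_smul,
          ← Finset.smul_sum, a]
    _ = 0 := sum_neg_one_pow_smul_eq_zero (succAbove_predAbove_invariant ha)

end Boundary

/-- The coordinates `1 / (n + 1)` of the barycenter of `Δ_n`. -/
def mean (n : ℕ) : ℝ := 1 / ((n : ℝ) + 1)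

theorem mean_pos (n : ℕ) : 0 < mean n := by
  unfold mean
  positivity

theorem sum_sub_mean (x : Fin (n + 1) → ℝ) : ∑ i, (x i - mean n) = ∑ i, x i - 1 := by
  simp only [Finset.sum_sub_distrib, Finset.sum_const, Finset.card_univ, Fintype.card_fin, mean,
    nsmul_eq_mul]
  push_cast
  field_simp

/-- The total amount by which the coordinates of `x` exceed `c`. -/
def excess {ι : Type*} [Fintype ι] (c : ℝ) (x : ι → ℝ) : ℝ :=
  ∑ i, (max (x i) c - c)

/-- The total amount by which the coordinates of `x` fall short of `c`. -/
def deficit {ι : Type*} [Fintype ι] (c : ℝ) (x : ι → ℝ) : ℝ :=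
  ∑ i, (c - min (x i) c)

section Excess

variable {ι : Type*} [Fintype ι] (c : ℝ) (x : ι → ℝ)

theorem excess_nonneg : 0 ≤ excess c x :=
  Finset.sum_nonneg fun _ _ => sub_nonneg.2 (le_max_right _ _)

theorem deficit_nonneg : 0 ≤ deficit c x :=
  Finset.sum_nonneg fun _ _ => sub_nonneg.2 (min_le_right _ _)

theorem excess_sub_deficit : excess c x - deficit c x = ∑ i, (x i - c) := by
  rw [excess, deficit, ← Finset.sum_sub_distrib]
  exact Finset.sum_congr rfl fun i _ => by linear_combination min_add_max (x i) c

theorem max_sub_le_excess (i : ι) : max (x i) c - c ≤ excess c x :=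
  Finset.single_le_sum (f := fun i => max (x i) c - c)
    (fun _ _ => sub_nonneg.2 (le_max_right _ _)) (Finset.mem_univ i)

theorem deficit_eq_zero_iff : deficit c x = 0 ↔ ∀ i, c ≤ x i := by
  rw [deficit, Finset.sum_eq_zero_iff_of_nonneg fun _ _ => sub_nonneg.2 (min_le_right _ _)]
  simp [sub_eq_zero, eq_comm (a := c)]

end Excess

theorem excess_eq_deficit (x : Simplex n) : excess (mean n) x = deficit (mean n) x := by
  rw [← sub_eq_zero, excess_sub_deficit, sum_sub_mean, stdSimplex.sum_eq_one, sub_self]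

theorem eq_mean_of_mean_le {x : Simplex n} (h : ∀ i, mean n ≤ x i) (i : Fin (n + 1)) :
    x i = mean n := by
  have hle := max_sub_le_excess (mean n) x i
  rw [excess_eq_deficit, (deficit_eq_zero_iff _ _).2 h, max_eq_left (h i), sub_nonpos] at hle
  exact hle.antisymm (h i)

section Lambda

variable {f : ℝ → ℝ} (hf : Monotone f) (hc : f (mean n) = mean n)

theorem Lambda_of_le (f : ℝ → ℝ) {x : Fin (n + 1) → ℝ} {i : Fin (n + 1)} (hi : x i ≤ mean n) :
    Lambda n f x i = f (x i) :=
  if_pos hi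

include hf hc

theorem lambdaD_eq (x : Fin (n + 1) → ℝ) :
    lambdaD n f x = deficit (mean n) (f ∘ x) - deficit (mean n) x := by
  rw [lambdaD, deficit, deficit, ← Finset.sum_sub_distrib]
  refine Finset.sum_congr rfl fun i _ => ?_
  change (if x i ≤ mean n then _ else _) = _
  split_ifs with hi
  · rw [Function.comp_apply, min_eq_left hi, min_eq_left (hc ▸ hf hi)]
    ring
  · have hi' := (not_le.1 hi).le
    rw [Function.comp_apply, min_eq_right hi', min_eq_right (hc ▸ hf hi'), sub_self]

omit hf hc in
theorem lambdaDelta_eq (x : Fin (n + 1) → ℝ) :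
    lambdaDelta n f x = lambdaD n f x / excess (mean n) x := by
  rw [lambdaDelta, excess]
  congr 1
  refine Finset.sum_congr rfl fun i _ => ?_
  change (if x i ≤ mean n then _ else _) = _
  split_ifs with hi
  · rw [max_eq_right hi, sub_self]
  · rw [max_eq_left (not_le.1 hi).le, mean]

theorem Lambda_apply (x : Simplex n) (i : Fin (n + 1)) :
    Lambda n f x i = min (f (x i)) (mean n) +
      deficit (mean n) (f ∘ x) / excess (mean n) x * (max (x i) (mean n) - mean n) := by
  obtain hi | hi := le_or_gt (x i) (mean n)
  · rw [Lambda_of_le f hi, max_eq_right hi, min_eq_left (hc ▸ hf hi), sub_self, mul_zero, add_zero]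
  · have hpos : 0 < excess (mean n) x :=
      (sub_pos.2 (hi.trans_le (le_max_left _ _))).trans_le (max_sub_le_excess (mean n) x i)
    rw [max_eq_left hi.le, min_eq_right (hc ▸ hf hi.le)]
    change (if x i ≤ mean n then _ else x i + _ * (x i - mean n)) = _
    rw [if_neg hi.not_ge, lambdaDelta_eq, lambdaD_eq hf hc, ← excess_eq_deficit]
    field_simp
    ring

theorem min_Lambda (x : Simplex n) (i : Fin (n + 1)) :
    min (Lambda n f x i) (mean n) = min (f (x i)) (mean n) := by
  obtain hi | hi := le_total (x i) (mean n)
  · rw [Lambda_of_le f hi]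
  · have hle : mean n ≤ f (x i) := hc.symm.trans_le (hf hi)
    have hnonneg := mul_nonneg (div_nonneg (deficit_nonneg (mean n) (f ∘ x))
      (excess_nonneg (mean n) x)) (sub_nonneg.2 (le_max_right (x i) (mean n)))
    rw [Lambda_apply hf hc, min_eq_right hle]
    exact min_eq_right (le_add_of_nonneg_right hnonneg)

theorem max_Lambda_sub (x : Simplex n) (i : Fin (n + 1)) : max (Lambda n f x i) (mean n) - mean n =
    deficit (mean n) (f ∘ x) / excess (mean n) x * (max (x i) (mean n) - mean n) := by
  linear_combination min_add_max (Lambda n f x i) (mean n) - min_Lambda hf hc x i +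
    Lambda_apply hf hc x i

theorem deficit_Lambda (x : Simplex n) :
    deficit (mean n) (Lambda n f x) = deficit (mean n) (f ∘ x) :=
  Finset.sum_congr rfl fun i _ => by rw [min_Lambda hf hc, Function.comp_apply]

theorem deficit_comp_eq_zero {x : Simplex n} (hx : excess (mean n) x = 0) :
    deficit (mean n) (f ∘ x) = 0 := by
  rw [excess_eq_deficit, deficit_eq_zero_iff] at hx
  exact (deficit_eq_zero_iff _ _).2 fun i => hc ▸ hf (hx i)

theorem excess_Lambda (x : Simplex n) :
    excess (mean n) (Lambda n f x) = deficit (mean n) (f ∘ x) := by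
  simp only [excess, max_Lambda_sub hf hc, ← Finset.mul_sum]
  exact div_mul_cancel_of_imp (deficit_comp_eq_zero hf hc)

theorem Lambda_mem_stdSimplex (h0 : 0 ≤ f 0) (x : Simplex n) :
    Lambda n f x ∈ stdSimplex ℝ (Fin (n + 1)) := by
  refine ⟨fun i => ?_, ?_⟩
  · have hmin : 0 ≤ min (Lambda n f x i) (mean n) := by
      rw [min_Lambda hf hc]
      exact le_min (h0.trans (hf (stdSimplex.zero_le x i))) (mean_pos n).le
    exact hmin.trans (min_le_left _ _)
  · rw [← sub_eq_zero, ← sum_sub_mean, ← excess_sub_deficit, excess_Lambda hf hc,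
      deficit_Lambda hf hc, sub_self]

theorem Lambda_le_Lambda {x : Simplex n} {i j : Fin (n + 1)} (h : x i ≤ x j) :
    Lambda n f x i ≤ Lambda n f x j := by
  rw [Lambda_apply hf hc, Lambda_apply hf hc]
  have hnonneg := div_nonneg (deficit_nonneg (mean n) (f ∘ x)) (excess_nonneg (mean n) x)
  gcongr
  exact hf h

end Lambda

/-- Where the denominator `p` vanishes, the quotient is squeezed between `0` and `q`. -/
theorem continuous_div_mul_of_le {X : Type*} [TopologicalSpace X] {q p m : X → ℝ}
    (hq : Continuous q) (hp : Continuous p) (hm : Continuous m) (hq0 : ∀ x, 0 ≤ q x)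
    (hm0 : ∀ x, 0 ≤ m x) (hmp : ∀ x, m x ≤ p x) (hpq : ∀ x, p x = 0 → q x = 0) :
    Continuous fun x => q x / p x * m x := by
  refine continuous_iff_continuousAt.2 fun x => ?_
  by_cases hx : p x = 0
  · have hle (y) : q y / p y * m y ≤ q y := by
      rw [div_mul_eq_mul_div]
      exact div_le_of_le_mul₀ ((hm0 y).trans (hmp y)) (hq0 y)
        (mul_le_mul_of_nonneg_left (hmp y) (hq0 y))
    have hge (y) : 0 ≤ q y / p y * m y :=
      mul_nonneg (div_nonneg (hq0 y) ((hm0 y).trans (hmp y))) (hm0 y)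
    have hlim := hq.tendsto x
    rw [hpq x hx] at hlim
    rw [ContinuousAt, hx, div_zero, zero_mul]
    exact squeeze_zero hge hle hlim
  · exact (hq.continuousAt.div hp.continuousAt hx).mul hm.continuousAt

theorem continuous_Lambda {f : ℝ → ℝ} (hf : Monotone f) (hfc : Continuous f)
    (hc : f (mean n) = mean n) (i : Fin (n + 1)) :
    Continuous fun x : Simplex n => Lambda n f x i := by
  have hcoord := continuous_coord (n := n)
  simp only [Lambda_apply hf hc]
  refine ((hfc.comp (hcoord i)).min continuous_const).add (continuous_div_mul_of_le ?_ ?_ ?_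
    (fun x => deficit_nonneg _ _) (fun x => sub_nonneg.2 (le_max_right _ _))
    (fun x => max_sub_le_excess _ _ i) fun x hx => deficit_comp_eq_zero hf hc hx)
  · exact continuous_finsetSum _ fun j _ =>
      continuous_const.sub ((hfc.comp (hcoord j)).min continuous_const)
  · exact continuous_finsetSum _ fun j _ =>
      ((hcoord j).max continuous_const).sub continuous_const
  · exact ((hcoord i).max continuous_const).sub continuous_const

theorem Lambda_permute (f : ℝ → ℝ) (σ : Equiv.Perm (Fin (n + 1))) (x : Simplex n)
    (i : Fin (n + 1)) : Lambda n f (permute σ x) i = Lambda n f x (σ i) := by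
  have hD : lambdaD n f (permute σ x) = lambdaD n f x :=
    Equiv.sum_comp σ fun i => if x i ≤ mean n then x i - f (x i) else 0
  have hE : excess (mean n) (permute σ x) = excess (mean n) x :=
    Equiv.sum_comp σ fun i => max (x i) (mean n) - mean n
  simp only [Lambda, lambdaDelta_eq, hD, hE, permute_apply]

section LambdaHomeomorph

variable {e : ℝ ≃o ℝ} (hc : e (mean n) = mean n) (h0 : e 0 = 0)

include hc

theorem Lambda_symm_Lambda {x y : Simplex n} (hy : ⇑y = Lambda n e x) :
    Lambda n e.symm y = x := by
  have hc' : e.symm (mean n) = mean n := by rw [e.symm_apply_eq, hc]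
  have hmin (i) : min (e.symm (y i)) (mean n) = min (x i) (mean n) := by
    apply e.injective
    rw [e.monotone.map_min, e.apply_symm_apply, e.monotone.map_min, hc, hy,
      min_Lambda e.monotone hc]
  have hdeficit : deficit (mean n) (e.symm ∘ y) = excess (mean n) x := by
    rw [excess_eq_deficit]
    exact Finset.sum_congr rfl fun i _ => by rw [Function.comp_apply, hmin]
  have hexcess : excess (mean n) y = deficit (mean n) (e ∘ x) := by
    rw [hy, excess_Lambda e.monotone hc]
  funext i
  have hscale : excess (mean n) x / deficit (mean n) (e ∘ x) *
      (deficit (mean n) (e ∘ x) / excess (mean n) x * (max (x i) (mean n) - mean n)) =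
      max (x i) (mean n) - mean n := by
    obtain hx | hx := eq_or_ne (excess (mean n) x) 0
    · rw [hx, zero_div, zero_mul]
      exact (sub_nonneg.2 (le_max_right _ _)).antisymm (hx ▸ max_sub_le_excess (mean n) x i)
    · have hD : deficit (mean n) (e ∘ x) ≠ 0 := fun h => hx <| by
        rw [← hdeficit]
        exact deficit_comp_eq_zero e.symm.monotone hc' (hexcess.trans h)
      rw [← mul_assoc, div_mul_div_cancel₀ hD, div_self hx, one_mul]
  rw [Lambda_apply e.symm.monotone hc', hmin, hdeficit, hexcess, hy,
    max_Lambda_sub e.monotone hc, hscale]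
  linear_combination min_add_max (x i) (mean n)

/-- `Λ_n(e)` for an increasing homeomorphism `e` that fixes the endpoints of `[0, 1 / (n + 1)]`. -/
def lambdaHomeomorph : Simplex n ≃ₜ Simplex n :=
  have hc' : e.symm (mean n) = mean n := by rw [e.symm_apply_eq, hc]
  have h0' : e.symm 0 = 0 := by rw [e.symm_apply_eq, h0]
  { toFun := fun x => ⟨Lambda n e x, Lambda_mem_stdSimplex e.monotone hc h0.ge x⟩
    invFun := fun x => ⟨Lambda n e.symm x, Lambda_mem_stdSimplex e.symm.monotone hc' h0'.ge x⟩
    left_inv := fun x => DFunLike.coe_injective (Lambda_symm_Lambda hc rfl)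
    right_inv := fun x => DFunLike.coe_injective (Lambda_symm_Lambda hc' rfl)
    continuous_toFun := continuous_of_coord (continuous_Lambda e.monotone e.continuous hc)
    continuous_invFun :=
      continuous_of_coord (continuous_Lambda e.symm.monotone e.symm.continuous hc') }

theorem lambdaHomeomorph_mem_comfort : lambdaHomeomorph hc h0 ∈ Comfort n :=
  ⟨respectsPermutations_iff.2 fun σ x => DFunLike.ext _ _ (Lambda_permute e σ x),
    keepsOrder_iff.2 fun _ _ _ h => Lambda_le_Lambda e.monotone hc h⟩

end LambdaHomeomorph

section Kink

variable {a b c d t : ℝ}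

theorem lineThrough_left (a b c d : ℝ) : lineThrough a b c d a = b := by
  simp [lineThrough]

theorem lineThrough_right (h : a < c) : lineThrough a b c d c = d := by
  have := (sub_pos.2 h).ne'
  unfold lineThrough
  field_simp
  ring

theorem strictMono_lineThrough (hac : a < c) (hbd : b < d) :
    StrictMono (lineThrough a b c d) := fun s t hst => by
  have := div_pos (sub_pos.2 hbd) (sub_pos.2 hac)
  unfold lineThrough
  gcongr

theorem lineThrough_lineThrough (hac : a < c) (hbd : b < d) (t : ℝ) :
    lineThrough b a d c (lineThrough a b c d t) = t := by
  have := (sub_pos.2 hac).ne'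
  have := (sub_pos.2 hbd).ne'
  unfold lineThrough
  field_simp
  ring

/-- The polygon through `(0, 0)`, `(a, b)` and `(c, c)`, continued affinely to the line. -/
def kink (a b c t : ℝ) : ℝ :=
  if t ≤ a then lineThrough 0 0 a b t else lineThrough a b c c t

theorem kink_of_le (h : t ≤ a) : kink a b c t = b / a * t := by
  simp [kink, h, lineThrough]

theorem kink_self (ha : 0 < a) : kink a b c a = b := by
  rw [kink_of_le le_rfl, div_mul_cancel₀ _ ha.ne']

theorem kink_right (hac : a < c) : kink a b c c = c := by
  rw [kink, if_neg hac.not_ge, lineThrough_right hac]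

theorem kink_zero (ha : 0 < a) : kink a b c 0 = 0 := by
  rw [kink_of_le ha.le, mul_zero]

theorem strictMono_kink (ha : 0 < a) (hb : 0 < b) (hac : a < c) (hbc : b < c) :
    StrictMono (kink a b c) :=
  (strictMono_lineThrough ha hb).ite' (strictMono_lineThrough hac hbc)
    (fun _ _ hst ht => hst.le.trans ht) fun s t hs ht _ => by
      calc lineThrough 0 0 a b s ≤ lineThrough 0 0 a b a :=
            (strictMono_lineThrough ha hb).monotone hs
        _ = lineThrough a b c c a := by rw [lineThrough_right ha, lineThrough_left]
        _ < lineThrough a b c c t := strictMono_lineThrough hac hbc (not_le.1 ht)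

theorem kink_kink (ha : 0 < a) (hb : 0 < b) (hac : a < c) (hbc : b < c) (t : ℝ) :
    kink b a c (kink a b c t) = t := by
  have hle : kink a b c t ≤ b ↔ t ≤ a := by
    nth_rw 2 [← kink_self (b := b) (c := c) ha]
    exact (strictMono_kink ha hb hac hbc).le_iff_le
  obtain ht | ht := le_or_gt t a
  · rw [kink, if_pos (hle.2 ht), kink, if_pos ht, lineThrough_lineThrough ha hb]
  · rw [kink, if_neg (hle.not.2 ht.not_ge), kink, if_neg ht.not_ge,
      lineThrough_lineThrough hac hbc]

/-- `kink a b c` as an increasing homeomorphism of the line. -/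
def kinkOrderIso (ha : 0 < a) (hb : 0 < b) (hac : a < c) (hbc : b < c) : ℝ ≃o ℝ :=
  (strictMono_kink ha hb hac hbc).orderIsoOfRightInverse _ (kink b a c)
    (kink_kink hb ha hbc hac)

/-- `Λ_n` of the polygon through `(0, 0)`, `(a, b)` and `(1 / (n + 1), 1 / (n + 1))`. -/
def lambdaKink (ha : 0 < a) (hb : 0 < b) (han : a < mean n) (hbn : b < mean n) :
    Simplex n ≃ₜ Simplex n :=
  lambdaHomeomorph (e := kinkOrderIso ha hb han hbn) (kink_right han) (kink_zero ha)

theorem lambdaKink_mem_comfort (ha : 0 < a) (hb : 0 < b) (han : a < mean n) (hbn : b < mean n) :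
    lambdaKink ha hb han hbn ∈ Comfort n :=
  lambdaHomeomorph_mem_comfort _ _

theorem lambdaKink_apply_of_le (ha : 0 < a) (hb : 0 < b) (han : a < mean n) (hbn : b < mean n)
    {x : Simplex n} {i : Fin (n + 1)} (hi : x i ≤ mean n) :
    lambdaKink ha hb han hbn x i = kink a b (mean n) (x i) :=
  Lambda_of_le _ hi

theorem scalesBelow_lambdaKink (ha : 0 < a) (hb : 0 < b) (han : a < mean n) (hbn : b < mean n) :
    ScalesBelow (lambdaKink ha hb han hbn) a b where
  pos_left := ha
  pos_right := hb
  apply_eq_mul x i hi := by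
    rw [lambdaKink_apply_of_le ha hb han hbn (hi.trans han.le), kink_of_le hi]
  lt_apply x i hi := by
    have hmin := min_Lambda (kinkOrderIso ha hb han hbn).monotone (kink_right han) x i
    have hlt : b < kink a b (mean n) (x i) := by
      simpa only [kink_self ha] using strictMono_kink ha hb han hbn hi
    exact (lt_min hlt hbn).trans_le (hmin.ge.trans (min_le_left _ _))

end Kink

/-- `F` fixes the coordinates that are at most `a`. -/
def FixesBelow (F : Simplex n → Simplex n) (a : ℝ) : Prop :=
  ∀ x i, x i ≤ a → F x i = x i

theorem FixesBelow.mono {F : Simplex n → Simplex n} {a b : ℝ} (h : FixesBelow F b) (hab : a ≤ b) :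
    FixesBelow F a :=
  fun x i hx => h x i (hx.trans hab)

theorem ScalesBelow.fixesBelow {F : Simplex n → Simplex n} {a : ℝ} (h : ScalesBelow F a a) :
    FixesBelow F a := fun x i hx => by
  rw [h.apply_eq_mul x i hx, div_self h.pos_left.ne', one_mul]

theorem FixesBelow.scalesBelow {F : Simplex n ≃ₜ Simplex n} {a : ℝ} (h : FixesBelow F a)
    (h' : FixesBelow F.symm a) (ha : 0 < a) : ScalesBelow F a a where
  pos_left := ha
  pos_right := ha
  apply_eq_mul x i hx := by rw [h x i hx, div_self ha.ne', one_mul]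
  lt_apply x i hx := by
    by_contra! hle
    have heq := h' (F x) i hle
    rw [F.symm_apply_apply] at heq
    exact hx.not_ge (heq.trans_le hle)

/-- The image of `x` under the homothety with ratio `s` about the barycenter of `Δ_n`. -/
def homothety (s : unitInterval) (x : Simplex n) : Simplex n :=
  ⟨fun l => (1 - s) * mean n + s * x l, by
    refine ⟨fun l => add_nonneg (mul_nonneg (sub_nonneg.2 s.2.2) (mean_pos n).le)
      (mul_nonneg s.2.1 (stdSimplex.zero_le x l)), ?_⟩
    have hsum : ∑ l, ((s : ℝ) * (x l - mean n)) = 0 := by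
      rw [← Finset.mul_sum, sum_sub_mean, stdSimplex.sum_eq_one, sub_self, mul_zero]
    rw [← sub_eq_zero, ← sum_sub_mean, ← hsum]
    exact Finset.sum_congr rfl fun l _ => by ring⟩

theorem homothety_apply (s : unitInterval) (x : Simplex n) (l : Fin (n + 1)) :
    homothety s x l = (1 - s) * mean n + s * x l := rfl

theorem homothety_zero (x : Simplex n) (l : Fin (n + 1)) : homothety 0 x l = mean n := by
  simp [homothety_apply]

theorem homothety_one (x : Simplex n) : homothety 1 x = x := by
  ext l
  simp [homothety_apply]

theorem homothety_le_homothety_iff {s : unitInterval} (hs : s ≠ 0) {x y : Simplex n}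
    {i j : Fin (n + 1)} : homothety s x i ≤ homothety s y j ↔ x i ≤ y j := by
  have hs' : 0 < (s : ℝ) := unitInterval.pos_iff_ne_zero.2 hs
  rw [homothety_apply, homothety_apply, add_le_add_iff_left, mul_le_mul_iff_right₀ hs']

theorem homothety_injective {s : unitInterval} (hs : s ≠ 0) :
    Function.Injective (homothety (n := n) s) := fun _ _ h => by
  ext l
  exact le_antisymm ((homothety_le_homothety_iff hs).1 (h ▸ le_rfl))
    ((homothety_le_homothety_iff hs).1 (h ▸ le_rfl))

theorem one_sub_mul_mean_le_homothety (s : unitInterval) (x : Simplex n) (l : Fin (n + 1)) :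
    (1 - s) * mean n ≤ homothety s x l :=
  le_add_of_nonneg_right (mul_nonneg s.2.1 (stdSimplex.zero_le x l))

/-- The point that divides the segment from the barycenter of `Δ_{n+1}` to the point `w` of the
`j`-th face in the ratio `s : 1 - s`. -/
def conePoint (j : Fin (n + 2)) (s : unitInterval) (w : Simplex n) : Simplex (n + 1) :=
  homothety s (insertCoord 0 j w)

theorem conePoint_apply_same (j : Fin (n + 2)) (s : unitInterval) (w : Simplex n) :
    conePoint j s w j = (1 - s) * mean (n + 1) := by
  simp [conePoint, homothety_apply]

theorem conePoint_permute (j j' : Fin (n + 2)) (s : unitInterval) (σ : Equiv.Perm (Fin (n + 1)))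
    (w : Simplex n) :
    conePoint j s (permute σ w) = permute (extendPerm j j' σ) (conePoint j' s w) := by
  rw [conePoint, insertCoord_permute 0 j j']
  rfl

theorem continuous_conePoint :
    Continuous fun p : Fin (n + 2) × unitInterval × Simplex n => conePoint p.1 p.2.1 p.2.2 := by
  refine continuous_prod_of_discrete_left.2 fun j => continuous_of_coord fun k => ?_
  have hinsert : Continuous fun p : unitInterval × Simplex n => insertCoord 0 j p.2 k :=
    (continuous_coord k).comp ((continuous_insertCoord 0 j).comp continuous_snd)
  simp only [conePoint, homothety_apply]
  fun_prop

/-- The smallest coordinate of `x` determines the face and the ratio. -/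
theorem exists_conePoint_eq (x : Simplex (n + 1)) :
    ∃ p : Fin (n + 2) × unitInterval × Simplex n, conePoint p.1 p.2.1 p.2.2 = x := by
  obtain ⟨j, hj⟩ := Finite.exists_min x
  obtain hmean | hlt := le_or_gt (mean (n + 1)) (x j)
  · have hx := eq_mean_of_mean_le fun l => hmean.trans (hj l)
    exact ⟨(j, 0, Classical.arbitrary _),
      DFunLike.ext _ _ fun l => (homothety_zero _ l).trans (hx l).symm⟩
  have hpos := mean_pos (n + 1)
  let s : unitInterval := ⟨1 - x j / mean (n + 1), sub_nonneg.2 ((div_le_one hpos).2 hlt.le),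
    sub_le_self _ (div_nonneg (stdSimplex.zero_le x j) hpos.le)⟩
  have hs : 0 < (s : ℝ) := sub_pos.2 ((div_lt_one hpos).2 hlt)
  have hsum : ∑ l, (x l - x j) / s = 1 := by
    rw [← Finset.sum_div, div_eq_one_iff_eq hs.ne', Finset.sum_sub_distrib, stdSimplex.sum_eq_one]
    simp [s, mean, mul_comm]
  let z : Simplex (n + 1) :=
    ⟨fun l => (x l - x j) / s, fun l => div_nonneg (sub_nonneg.2 (hj l)) hs.le, hsum⟩
  have hz : z j = 0 := by
    change (x j - x j) / (s : ℝ) = 0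
    rw [sub_self, zero_div]
  obtain ⟨w, hw⟩ := (sliceHomeomorph zero_lt_one j).surjective ⟨z, hz⟩
  refine ⟨(j, s, w), ?_⟩
  ext l
  rw [conePoint, show insertCoord 0 j w = z from congrArg Subtype.val hw, homothety_apply]
  change (1 - (1 - x j / mean (n + 1))) * mean (n + 1) + s * ((x l - x j) / s) = x l
  rw [mul_div_cancel₀ _ hs.ne', sub_sub_cancel, div_mul_cancel₀ _ hpos.ne', add_sub_cancel]

theorem conePoint_ratio_eq {j j' : Fin (n + 2)} {s s' : unitInterval} {w w' : Simplex n}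
    (h : conePoint j s w = conePoint j' s' w') : s = s' := by
  have hle := one_sub_mul_mean_le_homothety s (insertCoord 0 j w) j'
  have hge := one_sub_mul_mean_le_homothety s' (insertCoord 0 j' w') j
  rw [← conePoint, h, conePoint_apply_same] at hle
  rw [← conePoint, ← h, conePoint_apply_same] at hge
  have heq := mul_right_cancel₀ (mean_pos (n + 1)).ne' (hle.antisymm hge)
  exact Subtype.ext (sub_right_injective heq)

section Face

variable {f : Simplex n → Simplex n}

theorem insertCoord_zero_apply_of_fixesBelow {a : ℝ} (h : FixesBelow f a) {j l : Fin (n + 2)}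
    {w : Simplex n} (hw : insertCoord 0 j w l ≤ a) :
    insertCoord 0 j (f w) l = insertCoord 0 j w l := by
  obtain rfl | ⟨k, rfl⟩ := Fin.eq_self_or_eq_succAbove j l
  · simp only [insertCoord_apply_same]
  · simp only [insertCoord_apply_succAbove, Set.Icc.coe_zero, sub_zero, one_mul] at hw ⊢
    exact h w k hw

theorem insertCoord_zero_le_insertCoord_zero (hf : KeepsOrder f) (h0 : FixesBelow f 0)
    {j l l' : Fin (n + 2)} {w : Simplex n} (hw : insertCoord 0 j w l ≤ insertCoord 0 j w l') :
    insertCoord 0 j (f w) l ≤ insertCoord 0 j (f w) l' := by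
  obtain hl | hl := (stdSimplex.zero_le (insertCoord 0 j w) l).eq_or_lt
  · rw [insertCoord_zero_apply_of_fixesBelow h0 hl.ge, ← hl]
    exact stdSimplex.zero_le _ _
  · have hne {l} (hl : 0 < insertCoord 0 j w l) : l ≠ j := by
      rintro rfl
      simp at hl
    obtain ⟨k, rfl⟩ := Fin.exists_succAbove_eq (hne hl)
    obtain ⟨k', rfl⟩ := Fin.exists_succAbove_eq (hne (hl.trans_le hw))
    simpa using keepsOrder_iff.1 hf w k k' (by simpa using hw)

/-- A point common to the faces `j` and `j'` is fixed by the transposition of `j` and `j'`, and so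
is its image. -/
theorem insertCoord_zero_congr (hf : RespectsPermutations f) (h0 : FixesBelow f 0)
    {j j' : Fin (n + 2)} {w w' : Simplex n} (h : insertCoord 0 j w = insertCoord 0 j' w') :
    insertCoord 0 j (f w) = insertCoord 0 j' (f w') := by
  have hj' : insertCoord 0 j w j' = insertCoord 0 j w j := by
    conv_lhs => rw [h]
    rw [insertCoord_apply_same, insertCoord_apply_same]
  have hfj' : insertCoord 0 j (f w) j' = insertCoord 0 j (f w) j := by
    rw [insertCoord_zero_apply_of_fixesBelow h0 (by simp [hj']), hj', insertCoord_apply_same,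
      insertCoord_apply_same]
  obtain ⟨σ, hσ⟩ := exists_eq_extendPerm (Equiv.swap j' j) j'
  rw [Equiv.swap_apply_left] at hσ
  obtain rfl : w' = permute σ w := insertCoord_injective zero_lt_one j' <| by
    rw [insertCoord_permute 0 j' j, ← hσ, permute_swap_of_apply_eq hj', h]
  rw [respectsPermutations_iff.1 hf, insertCoord_permute 0 j' j, ← hσ,
    permute_swap_of_apply_eq hfj']

theorem conePoint_congr (hf : RespectsPermutations f) (h0 : FixesBelow f 0)
    {j j' : Fin (n + 2)} {s s' : unitInterval} {w w' : Simplex n}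
    (h : conePoint j s w = conePoint j' s' w') :
    conePoint j s (f w) = conePoint j' s' (f w') := by
  obtain rfl := conePoint_ratio_eq h
  obtain rfl | hs := eq_or_ne s 0
  · exact DFunLike.ext _ _ fun l => (homothety_zero _ l).trans (homothety_zero _ l).symm
  · exact congrArg _ (insertCoord_zero_congr hf h0 (homothety_injective hs h))

end Face

/-- `g` is the cone over `f`: on each face it is `f`, and it commutes with the homotheties about
the barycenter. -/
def IsCone (f : Simplex n → Simplex n) (g : Simplex (n + 1) → Simplex (n + 1)) : Prop :=
  ∀ j s w, g (conePoint j s w) = conePoint j s (f w)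

theorem exists_continuous_isCone {f : Simplex n → Simplex n} (hc : Continuous f)
    (hf : RespectsPermutations f) (h0 : FixesBelow f 0) :
    ∃ g : Simplex (n + 1) → Simplex (n + 1), Continuous g ∧ IsCone f g := by
  let q : C(Fin (n + 2) × unitInterval × Simplex n, Simplex (n + 1)) := ⟨_, continuous_conePoint⟩
  have hq : Topology.IsQuotientMap q :=
    .of_surjective_continuous exists_conePoint_eq continuous_conePoint
  let h : C(Fin (n + 2) × unitInterval × Simplex n, Simplex (n + 1)) :=
    ⟨fun p => conePoint p.1 p.2.1 (f p.2.2), continuous_conePoint.comp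
      (continuous_fst.prodMk (continuous_snd.fst.prodMk (hc.comp continuous_snd.snd)))⟩
  have hh (p p') (hp : q p = q p') : h p = h p' := conePoint_congr hf h0 hp
  exact ⟨hq.lift h hh, map_continuous _,
    fun j s w => DFunLike.congr_fun (hq.lift_comp h hh) (j, s, w)⟩

namespace IsCone

variable {f : Simplex n → Simplex n} {g : Simplex (n + 1) → Simplex (n + 1)}

theorem inducesOnSlices (h : IsCone f g) : InducesOnSlices g 0 0 f := fun j x => by
  simpa only [conePoint, homothety_one] using h j 1 x

theorem respectsPermutations (h : IsCone f g) (hf : RespectsPermutations f) :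
    RespectsPermutations g := by
  refine respectsPermutations_iff.2 fun τ x => ?_
  obtain ⟨⟨j, s, w⟩, rfl⟩ := exists_conePoint_eq x
  obtain ⟨σ, hσ⟩ := exists_eq_extendPerm τ (τ.symm j)
  rw [τ.apply_symm_apply] at hσ
  rw [hσ, ← conePoint_permute, h, h, respectsPermutations_iff.1 hf, ← conePoint_permute]

theorem keepsOrder (h : IsCone f g) (hf : KeepsOrder f) (h0 : FixesBelow f 0) :
    KeepsOrder g := by
  refine keepsOrder_iff.2 fun x l l' hx => ?_
  obtain ⟨⟨j, s, w⟩, rfl⟩ := exists_conePoint_eq x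
  rw [h]
  obtain rfl | hs := eq_or_ne s 0
  · exact ((homothety_zero _ l).trans (homothety_zero _ l').symm).le
  · exact (homothety_le_homothety_iff hs).2
      (insertCoord_zero_le_insertCoord_zero hf h0 ((homothety_le_homothety_iff hs).1 hx))

theorem fixesBelow (h : IsCone f g) {a : ℝ} (ha : a ≤ mean (n + 1)) (hf : FixesBelow f a) :
    FixesBelow g a := by
  intro x l hx
  obtain ⟨⟨j, s, w⟩, rfl⟩ := exists_conePoint_eq x
  rw [h]
  obtain rfl | hs := eq_or_ne s 0
  · exact (homothety_zero _ l).trans (homothety_zero _ l).symm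
  have hw : insertCoord 0 j w l ≤ a := by
    have hmean := mul_le_mul_of_nonneg_left ha (sub_nonneg.2 s.2.2)
    have hs' : 0 < (s : ℝ) := unitInterval.pos_iff_ne_zero.2 hs
    change (1 - s) * mean (n + 1) + s * insertCoord 0 j w l ≤ a at hx
    exact le_of_mul_le_mul_left (by linarith) hs'
  change homothety s (insertCoord 0 j (f w)) l = homothety s (insertCoord 0 j w) l
  rw [homothety_apply, homothety_apply, insertCoord_zero_apply_of_fixesBelow hf hw]

theorem leftInverse {f' : Simplex n → Simplex n} {g' : Simplex (n + 1) → Simplex (n + 1)}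
    (h : IsCone f g) (h' : IsCone f' g') (hf : Function.LeftInverse f' f) :
    Function.LeftInverse g' g := fun x => by
  obtain ⟨⟨j, s, w⟩, rfl⟩ := exists_conePoint_eq x
  rw [h, h', hf]

end IsCone

theorem exists_isCone {F : Simplex n ≃ₜ Simplex n} (hF : F ∈ Comfort n) {a : ℝ}
    (h : ScalesBelow F a a) (ha : a ≤ mean (n + 1)) :
    ∃ G ∈ Comfort (n + 1), ScalesBelow G a a ∧ IsCone F G := by
  have h0 := h.fixesBelow.mono h.pos_left.le
  have h0' := h.symm.fixesBelow.mono h.pos_left.le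
  obtain ⟨g, hgc, hg⟩ := exists_continuous_isCone F.continuous hF.1 h0
  obtain ⟨g', hgc', hg'⟩ :=
    exists_continuous_isCone F.symm.continuous (symm_mem_comfort hF).1 h0'
  let G : Simplex (n + 1) ≃ₜ Simplex (n + 1) :=
    { toFun := g
      invFun := g'
      left_inv := hg.leftInverse hg' F.left_inv
      right_inv := hg'.leftInverse hg F.right_inv
      continuous_toFun := hgc
      continuous_invFun := hgc' }
  have hfix : FixesBelow G a := hg.fixesBelow ha h.fixesBelow
  have hfix' : FixesBelow G.symm a := hg'.fixesBelow ha h.symm.fixesBelow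
  exact ⟨G, ⟨hg.respectsPermutations hF.1, hg.keepsOrder hF.2 h0⟩,
    hfix.scalesBelow hfix' h.pos_left, hg⟩

/-- The map `Λ(kink a b)` makes the faces fit a map that fixes the coordinates up to `b`, so that
the cone does not disturb the small coordinates. -/
theorem exists_extension {U : Simplex n ≃ₜ Simplex n} (hU : U ∈ Comfort n) {a b : ℝ}
    (h : ScalesBelow U a b) (ha : a < mean (n + 1)) (hb : b < mean (n + 1)) :
    ∃ G ∈ Comfort (n + 1), ScalesBelow G a b ∧ InducesOnSlices G 0 0 U := by
  let P := lambdaKink h.pos_left h.pos_right ha hb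
  have hP : P ∈ Comfort (n + 1) := lambdaKink_mem_comfort _ _ _ _
  have hPab : ScalesBelow P a b := scalesBelow_lambdaKink _ _ _ _
  obtain ⟨Q, hPQ⟩ := exists_inducesOnSlices hP zero_lt_one zero_lt_one hPab.apply_eq_zero_iff
  have hQab := hPQ.scalesBelow hPab zero_lt_one zero_lt_one
  simp only [Set.Icc.coe_zero, sub_zero, div_one] at hQab
  have hQ := hPQ.mem_comfort hP zero_lt_one
  obtain ⟨C, hC, hCb, hcone⟩ := exists_isCone (trans_mem_comfort (symm_mem_comfort hQ) hU)
    (hQab.symm.trans h) hb.le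
  refine ⟨P.trans C, trans_mem_comfort hP hC, hPab.trans hCb, fun j x => ?_⟩
  rw [Homeomorph.trans_apply, hPQ, hcone.inducesOnSlices, Homeomorph.trans_apply,
    Q.symm_apply_apply]

/-- The height `1 / (2 (n + 1))` of the upper face maps into `Δ_n`. -/
def level (n : ℕ) : ℝ := 1 / (2 * ((n : ℝ) + 1))

/-- The coordinate `1 / (2 (n + 1) + 1)` to which `Θ_{n,1}` sends the coordinate `level n`. -/
def crossLevel (n : ℕ) : ℝ := 1 / (2 * ((n : ℝ) + 1) + 1)

theorem level_pos (n : ℕ) : 0 < level n := by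
  unfold level
  positivity

theorem crossLevel_pos (n : ℕ) : 0 < crossLevel n := by
  unfold crossLevel
  positivity

theorem crossLevel_lt_level (n : ℕ) : crossLevel n < level n := by
  unfold level crossLevel
  gcongr
  exact lt_add_one _

theorem level_lt_mean (n : ℕ) : level n < mean n := by
  unfold level mean
  gcongr
  exact lt_mul_of_one_lt_left (by positivity) one_lt_two

theorem level_succ_lt_level (n : ℕ) : level (n + 1) < level n := by
  unfold level
  gcongr
  exact n.lt_succ_self

theorem crossLevel_lt_mean (n : ℕ) : crossLevel n < mean n :=
  (crossLevel_lt_level n).trans (level_lt_mean n)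

theorem level_lt_one (n : ℕ) : level n < 1 := by
  refine (level_lt_mean n).trans_le ?_
  rw [mean, div_le_one (by positivity)]
  exact le_add_of_nonneg_left n.cast_nonneg

theorem level_succ_div_one_sub (n : ℕ) :
    level (n + 1) / (1 - level (n + 1)) = crossLevel n := by
  rw [div_eq_iff (sub_pos.2 (level_lt_one (n + 1))).ne']
  unfold level crossLevel
  push_cast
  field_simp
  ring

theorem height_zero (L n : ℕ) : height L n 0 = 0 := by
  simp [height]

theorem height_one_one (n : ℕ) : height 1 n 1 = level n := by
  simp [height, level, one_add_one_eq_two]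

theorem unitHeight_zero (L n : ℕ) : unitHeight L n 0 = 0 :=
  Subtype.ext (height_zero L n)

theorem coe_unitHeight_one (n : ℕ) : (unitHeight 1 n 1 : ℝ) = level n := height_one_one n

theorem unitHeight_lt_one (n : ℕ) (i : Fin 2) : unitHeight 1 n i < 1 := by
  fin_cases i
  · exact (unitHeight_zero 1 n).trans_lt zero_lt_one
  · exact Subtype.coe_lt_coe.1 ((coe_unitHeight_one n).trans_lt (level_lt_one n))

/-- The homeomorphism `Θ_{n,0} = Λ_n(φ_{n,0})`. -/
def thetaZero (n : ℕ) : Simplex n ≃ₜ Simplex n :=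
  lambdaKink (level_pos n) (level_pos (n + 1)) (level_lt_mean n)
    ((level_succ_lt_level n).trans (level_lt_mean n))

theorem coe_thetaZero (n : ℕ) (x : Simplex n) : ⇑(thetaZero n x) = Lambda n (phi n) x := by
  have hphi : kink (level n) (level (n + 1)) (mean n) = phi n := by
    have hlevel : level (n + 1) = 1 / (2 * ((n : ℝ) + 2)) := by
      rw [level, Nat.cast_succ, add_assoc, one_add_one_eq_two]
    rw [hlevel]
    rfl
  rw [← hphi]
  rfl

theorem thetaZero_mem_comfort (n : ℕ) : thetaZero n ∈ Comfort n :=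
  lambdaKink_mem_comfort _ _ _ _

theorem scalesBelow_thetaZero (n : ℕ) : ScalesBelow (thetaZero n) (level n) (level (n + 1)) :=
  scalesBelow_lambdaKink _ _ _ _

/-- The relation between `F = Θ_{n,1}` and `G = Θ_{n+1,1}` expressed by the face equations with
`i ≠ k`: the restriction of `G` to the faces is prescribed by `F`. -/
def FaceCompatible (F : Simplex n ≃ₜ Simplex n) (G : Simplex (n + 1) ≃ₜ Simplex (n + 1)) : Prop :=
  ∃ U V : Simplex n → Simplex n, InducesOnSlices G 0 0 U ∧
    InducesOnSlices (thetaZero (n + 1)) (unitHeight 1 (n + 1) 1) (unitHeight 1 (n + 2) 1) V ∧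
    ∀ x, U (thetaZero n x) = V (F x)

theorem exists_faceCompatible {F : Simplex n ≃ₜ Simplex n} (hF : F ∈ Comfort n)
    (hFl : ScalesBelow F (level n) (crossLevel n)) :
    ∃ G ∈ Comfort (n + 1), ScalesBelow G (level (n + 1)) (crossLevel (n + 1)) ∧
      FaceCompatible F G := by
  have hZ := scalesBelow_thetaZero (n + 1)
  have hlt := unitHeight_lt_one (n + 1) 1
  have hlt' := unitHeight_lt_one (n + 2) 1
  obtain ⟨V, hV⟩ := exists_inducesOnSlices (thetaZero_mem_comfort (n + 1)) hlt hlt' fun x j => by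
    rw [coe_unitHeight_one, coe_unitHeight_one, hZ.apply_eq_iff]
  have hVl := hV.scalesBelow hZ hlt hlt'
  rw [coe_unitHeight_one, coe_unitHeight_one, level_succ_div_one_sub,
    level_succ_div_one_sub] at hVl
  let U := ((thetaZero n).symm.trans F).trans V
  have hU : U ∈ Comfort n :=
    trans_mem_comfort (trans_mem_comfort (symm_mem_comfort (thetaZero_mem_comfort n)) hF)
      (hV.mem_comfort (thetaZero_mem_comfort (n + 1)) hlt')
  have hUl : ScalesBelow U (level (n + 1)) (crossLevel (n + 1)) :=
    ((scalesBelow_thetaZero n).symm.trans hFl).trans hVl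
  obtain ⟨G, hG, hGl, hGU⟩ :=
    exists_extension hU hUl (level_lt_mean (n + 1)) (crossLevel_lt_mean (n + 1))
  refine ⟨G, hG, hGl, U, V, hGU, hV, fun x => ?_⟩
  simp only [U, Homeomorph.trans_apply, Homeomorph.symm_apply_apply]

theorem scalesBelow_refl_zero :
    ScalesBelow (Homeomorph.refl (Simplex 0)) (level 0) (crossLevel 0) := by
  have hx (x : Simplex 0) (i) : x i = 1 := by
    rw [← stdSimplex.sum_eq_one x, Fin.sum_univ_one, Fin.fin_one_eq_zero i]
  refine ⟨level_pos 0, crossLevel_pos 0, fun x i hi => ?_, fun x i hi => ?_⟩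
  · exact absurd (level_lt_one 0) (hx x i ▸ hi).not_gt
  · exact (crossLevel_lt_level 0).trans hi

theorem exists_thetaOne : ∃ F : ∀ n, Simplex n ≃ₜ Simplex n, ∀ n, F n ∈ Comfort n ∧
    ScalesBelow (F n) (level n) (crossLevel n) ∧ FaceCompatible (F n) (F (n + 1)) := by
  have hstep (n) (F : {F // F ∈ Comfort n ∧ ScalesBelow F (level n) (crossLevel n)}) :=
    exists_faceCompatible F.2.1 F.2.2
  choose G hG hGl hGF using hstep
  let F (n : ℕ) : {F // F ∈ Comfort n ∧ ScalesBelow F (level n) (crossLevel n)} :=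
    n.rec ⟨Homeomorph.refl _, refl_mem_comfort, scalesBelow_refl_zero⟩
      fun n F => ⟨G n F, hG n F, hGl n F⟩
  exact ⟨fun n => (F n).1, fun n => ⟨(F n).2.1, (F n).2.2, hGF n (F n)⟩⟩

theorem faceEquation_self {L : ℕ} {Θ : HomeoFamily L} {i : Fin (L + 1)}
    (hΘ : Θ (n + 1) i ∈ Comfort (n + 1)) (hi : unitHeight L (n + 1) i < 1) {b : unitInterval}
    (hb : b < 1) (hb' : (1 - height L (n + 2) i) * b = height L (n + 2) i)
    (h : ∀ x j, Θ (n + 1) i x j = b ↔ x j = height L (n + 1) i) {j p : Fin (n + 2)}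
    (hjp : j ≤ p) : FaceEquation L Θ n j p i i := by
  obtain ⟨H, hH⟩ := exists_inducesOnSlices hΘ hi hb h
  exact faceEquation_of_inducesOnSlices hH hH hb' hb' (fun _ => rfl) hjp

/-- The family with `Θ_{n,0} = Λ_n(φ_{n,0})` and `Θ_{n,1} = F n`. -/
def theta (F : ∀ n, Simplex n ≃ₜ Simplex n) : HomeoFamily 1 :=
  fun n => ![thetaZero n, F n]

section Theta

variable {F : ∀ n, Simplex n ≃ₜ Simplex n} {j p : Fin (n + 2)}

theorem faceEquation_theta_zero_zero (hjp : j ≤ p) : FaceEquation 1 (theta F) n j p 0 0 := by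
  refine faceEquation_self (b := 0) (thetaZero_mem_comfort (n + 1)) (unitHeight_lt_one _ 0)
    zero_lt_one ?_ ?_ hjp
  · rw [height_zero, Set.Icc.coe_zero, mul_zero]
  · rw [height_zero]
    exact (scalesBelow_thetaZero (n + 1)).apply_eq_zero_iff

theorem faceEquation_theta_one_one (hF : F (n + 1) ∈ Comfort (n + 1))
    (hFl : ScalesBelow (F (n + 1)) (level (n + 1)) (crossLevel (n + 1))) (hjp : j ≤ p) :
    FaceEquation 1 (theta F) n j p 1 1 := by
  have hlt : crossLevel (n + 1) < 1 := (crossLevel_lt_level _).trans (level_lt_one _)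
  refine faceEquation_self (b := ⟨crossLevel (n + 1), (crossLevel_pos _).le, hlt.le⟩) hF
    (unitHeight_lt_one _ 1) hlt ?_ ?_ hjp
  · simp only [height_one_one, ← level_succ_div_one_sub (n + 1)]
    exact mul_div_cancel₀ _ (sub_pos.2 (level_lt_one _)).ne'
  · rw [height_one_one]
    exact hFl.apply_eq_iff

theorem faceEquation_theta_zero_one_and_one_zero (h : FaceCompatible (F n) (F (n + 1)))
    (hjp : j ≤ p) :
    FaceEquation 1 (theta F) n j p 0 1 ∧ FaceEquation 1 (theta F) n j p 1 0 := by
  obtain ⟨U, V, hU, hV, hUV⟩ := h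
  have hU' : InducesOnSlices (F (n + 1)) (unitHeight 1 (n + 1) 0) 0 U := by
    rwa [unitHeight_zero]
  have hzero : (1 - height 1 (n + 2) 0) * unitHeight 1 (n + 2) 1 = height 1 (n + 2) 1 := by
    rw [height_zero, sub_zero, one_mul, unitHeight]
  have hone : (1 - height 1 (n + 2) 1) * (0 : unitInterval) = height 1 (n + 2) 0 := by
    rw [height_zero, Set.Icc.coe_zero, mul_zero]
  exact ⟨faceEquation_of_inducesOnSlices hV hU' hzero hone (fun x => (hUV x).symm) hjp,
    faceEquation_of_inducesOnSlices hU' hV hone hzero hUV hjp⟩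

theorem faceEquation_theta (hF : F (n + 1) ∈ Comfort (n + 1))
    (hFl : ScalesBelow (F (n + 1)) (level (n + 1)) (crossLevel (n + 1)))
    (h : FaceCompatible (F n) (F (n + 1))) (hjp : j ≤ p) :
    ∀ i k, FaceEquation 1 (theta F) n j p i k
  | 0, 0 => faceEquation_theta_zero_zero hjp
  | 0, 1 => (faceEquation_theta_zero_one_and_one_zero h hjp).1
  | 1, 0 => (faceEquation_theta_zero_one_and_one_zero h hjp).2
  | 1, 1 => faceEquation_theta_one_one hF hFl hjp

end Theta

end SimplexBoundary

end

theorem theorem2 :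
    ∃ Θ : HomeoFamily 1,
      -- `Θ_{n,0} = Λ_n(φ_{n,0})`
      (∀ (n : ℕ) (x : Simplex n),
        ⇑(Θ n 0 x) = Lambda n (phi n) ⇑x) ∧
      (∀ n : ℕ, Θ n 0 ∈ Comfort n) ∧
      (∀ n : ℕ, Θ n 1 ∈ Comfort n) ∧
      (∀ (n : ℕ) (j p : Fin (n + 2)), j ≤ p → ∀ i k : Fin 2, FaceEquation 1 Θ n j p i k) ∧
      -- `Θ_{n,1}` restricts to a homeomorphism between the two crosses
      (∀ n : ℕ, ∃ h : cross n (1 / (2 * ((n : ℝ) + 1))) ≃ₜ cross n (1 / (2 * ((n : ℝ) + 1) + 1)),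
        ∀ x, ((h x : cross n _) : Simplex n) = Θ n 1 (x : Simplex n)) ∧
      (∀ (R : Type*) [CommRing R] (X : Type*) [TopologicalSpace X] (m : Fin 2 → R) (n : ℕ),
        (boundary Θ m X n) ∘ₗ (boundary Θ m X (n + 1)) = 0) := by
  obtain ⟨F, hF⟩ := exists_thetaOne
  have hface (n : ℕ) (j p : Fin (n + 2)) (hjp : j ≤ p) :
      ∀ i k, FaceEquation 1 (theta F) n j p i k :=
    faceEquation_theta (hF (n + 1)).1 (hF (n + 1)).2.1 (hF n).2.2 hjp
  exact ⟨theta F, coe_thetaZero, thetaZero_mem_comfort, fun n => (hF n).1, hface,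
    fun n => ⟨(hF n).2.1.crossHomeomorph, fun _ => rfl⟩,
    fun _ _ _ _ m n => boundary_comp_boundary (theta F) m (hface n)⟩
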